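/- Let $A,B,D,\tilde A,\tilde B,\tilde D$ be C$^*$-algebras (not necessarily unital), and let $\phi_A:D\to A$, $\phi_B:D\to B$, $\phi_{\tilde A}:\tilde D\to\tilde A$, $\phi_{\tilde B}:\tilde D\to\tilde B$, $\lambda_A:A\to\tilde A$, $\lambda_D:D\to\tilde D$, $\lambda_B:B\to\tilde B$ be injective $*$-homomorphisms with $\lambda_A\circ\phi_A=\phi_{\tilde A}\circ\lambda_D$ and $\lambda_B\circ\phi_B=\phi_{\tilde B}\circ\lambda_D$; regard all of them as inclusions. Let $A*_DB$ and $\tilde A*_{\tilde D}\tilde B$ be the full amalgamated free product C$^*$-algebras: $A*_DB$ is generated by the images of $*$-homomorphisms $\sigma_A:A\to A*_DB$ and $\sigma_B:B\to A*_DB$ with $\sigma_A\circ\phi_A=\sigma_B\circ\phi_B$, and every pair of $*$-homomorphisms $\pi_A:A\to C$, $\pi_B:B\to C$ to a C$^*$-algebra $C$ with $\pi_A\circ\phi_A=\pi_B\circ\phi_B$ factors as $\pi_A=\pi\circ\sigma_A$, $\pi_B=\pi\circ\sigma_B$ for a $*$-homomorphism $\pi:A*_DB\to C$; likewise for $\tilde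 A*_{\tilde D}\tilde B$. Let $\lambda:A*_DB\to\tilde A*_{\tilde D}\tilde B$ be the $*$-homomorphism arising from $\lambda_A$ and $\lambda_B$ via the universal property. Suppose that one of the following holds: (i) $D=0$; (ii) $D=\mathbb C$, $A$ and $B$ are unital, and the inclusions $D\hookrightarrow A$ and $D\hookrightarrow B$ are unital. Suppose that there are $\tilde d\in\tilde D$, $a_1,a_2\in A$ and $b\in B\setminus D$ such that $a_1\tilde d\in A$, $\tilde d a_2\in A$, $a_1\tilde d\notin\mathbb C a_1$, $a_2\neq0$, and $\tilde d b=b\tilde d$. Then $\lambda$ is not injective. -/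

import Mathlib

open scoped ENNReal

universe u

noncomputable section

namespace CStarAmalgam

/-- Formal noncommutative `*`-polynomials without constant term in the elements of two sets. -/
inductive StarPoly (A B : Type u) : Type u
  | inl (a : A) : StarPoly A B
  | inr (b : B) : StarPoly A B
  | add (x y : StarPoly A B) : StarPoly A B
  | mul (x y : StarPoly A B) : StarPoly A B
  | smul (c : ℂ) (x : StarPoly A B) : StarPoly A B
  | star (x : StarPoly A B) : StarPoly A B

/-- The value of a formal `*`-polynomial in a C⋆-algebra, after substituting along `f` and `g`. -/
def StarPoly.eval {A B C : Type u} [NonUnitalCStarAlgebra C] (f : A → C) (g : B → C) :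
    StarPoly A B → C
  | .inl a => f a
  | .inr b => g b
  | .add x y => x.eval f g + y.eval f g
  | .mul x y => x.eval f g * y.eval f g
  | .smul c x => c • x.eval f g
  | .star x => Star.star (x.eval f g)

variable {A B D : Type u} [NonUnitalCStarAlgebra A] [NonUnitalCStarAlgebra B]
  [NonUnitalCStarAlgebra D]

/-- A pair of `*`-homomorphisms from `A` and `B` to a common C⋆-algebra that agree on `D`. -/
structure CompatPair (φA : D →⋆ₙₐ[ℂ] A) (φB : D →⋆ₙₐ[ℂ] B) : Type (u + 1) where
  C : Type u
  [inst : NonUnitalCStarAlgebra C]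
  πA : A →⋆ₙₐ[ℂ] C
  πB : B →⋆ₙₐ[ℂ] C
  compat : πA.comp φA = πB.comp φB

attribute [instance] CompatPair.inst

variable (φA : D →⋆ₙₐ[ℂ] A) (φB : D →⋆ₙₐ[ℂ] B)

variable {φA φB} in
/-- The function on formal `*`-polynomials given by the norm of their value in a pair. -/
def CompatPair.normFn (Q : CompatPair φA φB) (e : StarPoly A B) : ℝ := ‖e.eval Q.πA Q.πB‖

/-- A small index set for the compatible pairs: two pairs are identified if they give the same norm
to every formal `*`-polynomial. -/
abbrev Idx : Type u := Set.range (CompatPair.normFn (φA := φA) (φB := φB))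

/-- A compatible pair representing an index. -/
def rep (i : Idx φA φB) : CompatPair φA φB := i.2.choose

lemma rep_spec (i : Idx φA φB) : (rep φA φB i).normFn = i.1 := i.2.choose_spec

/-- The bounded product of the targets of representatives of all compatible pairs. -/
abbrev BigProd : Type u := lp (fun i : Idx φA φB => (rep φA φB i).C) ∞

/-- A family of `*`-homomorphisms as one `*`-homomorphism to the bounded product. -/
def bigHom {E : Type u} [NonUnitalCStarAlgebra E]
    (f : ∀ i : Idx φA φB, E →⋆ₙₐ[ℂ] (rep φA φB i).C) : E →⋆ₙₐ[ℂ] BigProd φA φB where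
  toFun a := ⟨fun i => f i a, memℓp_infty ⟨‖a‖, by
    rintro _ ⟨i, rfl⟩
    exact NonUnitalStarAlgHom.norm_apply_le (f i) a⟩⟩
  map_smul' c a := by ext i; exact map_smul (f i) c a
  map_zero' := by ext i; exact map_zero (f i)
  map_add' a b := by ext i; exact map_add (f i) a b
  map_mul' a b := by ext i; exact map_mul (f i) a b
  map_star' a := by ext i; exact map_star (f i) a

/-- The map of `A` to the bounded product. -/
def inlBig : A →⋆ₙₐ[ℂ] BigProd φA φB := bigHom φA φB fun i => (rep φA φB i).πA

/-- The map of `B` to the bounded product. -/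
def inrBig : B →⋆ₙₐ[ℂ] BigProd φA φB := bigHom φA φB fun i => (rep φA φB i).πB

/-- The C⋆-subalgebra generated by the images of two `*`-homomorphisms. -/
abbrev gen {C : Type u} [NonUnitalCStarAlgebra C] (f : A →⋆ₙₐ[ℂ] C) (g : B →⋆ₙₐ[ℂ] C) :
    NonUnitalStarSubalgebra ℂ C :=
  (NonUnitalStarAlgebra.adjoin ℂ (Set.range f ∪ Set.range g)).topologicalClosure

lemma inl_mem_gen {C : Type u} [NonUnitalCStarAlgebra C] (f : A →⋆ₙₐ[ℂ] C) (g : B →⋆ₙₐ[ℂ] C)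
    (a : A) : f a ∈ gen f g :=
  NonUnitalStarSubalgebra.le_topologicalClosure _
    (NonUnitalStarAlgebra.subset_adjoin ℂ _ (Or.inl ⟨a, rfl⟩))

lemma inr_mem_gen {C : Type u} [NonUnitalCStarAlgebra C] (f : A →⋆ₙₐ[ℂ] C) (g : B →⋆ₙₐ[ℂ] C)
    (b : B) : g b ∈ gen f g :=
  NonUnitalStarSubalgebra.le_topologicalClosure _
    (NonUnitalStarAlgebra.subset_adjoin ℂ _ (Or.inr ⟨b, rfl⟩))

instance {C : Type u} [NonUnitalCStarAlgebra C] (f : A →⋆ₙₐ[ℂ] C) (g : B →⋆ₙₐ[ℂ] C) :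
    IsClosed (gen f g : Set C) :=
  NonUnitalStarSubalgebra.isClosed_topologicalClosure _

/-- Every element of the generated `*`-algebra is the value of a formal `*`-polynomial. -/
lemma exists_starPoly {C : Type u} [NonUnitalCStarAlgebra C] (f : A →⋆ₙₐ[ℂ] C) (g : B →⋆ₙₐ[ℂ] C)
    (x : C) (hx : x ∈ NonUnitalStarAlgebra.adjoin ℂ (Set.range f ∪ Set.range g)) :
    ∃ e : StarPoly A B, e.eval f g = x := by
  induction hx using NonUnitalStarAlgebra.adjoin_induction with
  | mem x hx =>
    rcases hx with ⟨a, rfl⟩ | ⟨b, rfl⟩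
    · exact ⟨.inl a, rfl⟩
    · exact ⟨.inr b, rfl⟩
  | add x y _ _ hx hy =>
    obtain ⟨e, rfl⟩ := hx
    obtain ⟨e', rfl⟩ := hy
    exact ⟨.add e e', rfl⟩
  | zero => exact ⟨.inl 0, map_zero f⟩
  | mul x y _ _ hx hy =>
    obtain ⟨e, rfl⟩ := hx
    obtain ⟨e', rfl⟩ := hy
    exact ⟨.mul e e', rfl⟩
  | smul r x _ hx =>
    obtain ⟨e, rfl⟩ := hx
    exact ⟨.smul r e, rfl⟩
  | star x _ hx =>
    obtain ⟨e, rfl⟩ := hx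
    exact ⟨.star e, rfl⟩

lemma map_eval {A B C C' : Type u} [NonUnitalCStarAlgebra C] [NonUnitalCStarAlgebra C']
    (h : C →⋆ₙₐ[ℂ] C') (f : A → C) (g : B → C) (e : StarPoly A B) :
    h (e.eval f g) = e.eval (fun a => h (f a)) (fun b => h (g b)) := by
  induction e with
  | inl a => rfl
  | inr b => rfl
  | add x y hx hy => simp [StarPoly.eval, hx, hy]
  | mul x y hx hy => simp [StarPoly.eval, hx, hy]
  | smul c x hx => simp [StarPoly.eval, hx]
  | star x hx => simp only [StarPoly.eval, map_star, hx]

lemma eval_mem {C : Type u} [NonUnitalCStarAlgebra C] (f : A →⋆ₙₐ[ℂ] C) (g : B →⋆ₙₐ[ℂ] C)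
    (e : StarPoly A B) :
    e.eval f g ∈ NonUnitalStarAlgebra.adjoin ℂ (Set.range f ∪ Set.range g) := by
  induction e with
  | inl a => exact NonUnitalStarAlgebra.subset_adjoin ℂ _ (Or.inl ⟨a, rfl⟩)
  | inr b => exact NonUnitalStarAlgebra.subset_adjoin ℂ _ (Or.inr ⟨b, rfl⟩)
  | add x y hx hy => exact add_mem hx hy
  | mul x y hx hy => exact mul_mem hx hy
  | smul c x hx => exact SMulMemClass.smul_mem c hx
  | star x hx => exact star_mem hx

lemma continuous_starHom {C C' : Type u} [NonUnitalCStarAlgebra C] [NonUnitalCStarAlgebra C']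
    (h : C →⋆ₙₐ[ℂ] C') : Continuous h :=
  AddMonoidHomClass.continuous_of_bound h 1 fun x => by
    simpa using NonUnitalStarAlgHom.norm_apply_le h x

/-- If one pair of `*`-homomorphisms dominates another in norm on all formal `*`-polynomials, then
the C⋆-algebra generated by the first maps to the target of the second. -/
theorem exists_hom_of_norm_le {L C : Type u} [NonUnitalCStarAlgebra L] [NonUnitalCStarAlgebra C]
    (i : A →⋆ₙₐ[ℂ] L) (j : B →⋆ₙₐ[ℂ] L) (πA : A →⋆ₙₐ[ℂ] C) (πB : B →⋆ₙₐ[ℂ] C)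
    (h : ∀ e : StarPoly A B, ‖e.eval πA πB‖ ≤ ‖e.eval i j‖) :
    ∃ π : gen i j →⋆ₙₐ[ℂ] C, (∀ a, π ⟨i a, inl_mem_gen i j a⟩ = πA a) ∧
      ∀ b, π ⟨j b, inr_mem_gen i j b⟩ = πB b := by
  let f : A →⋆ₙₐ[ℂ] L × C := i.prod πA
  let g : B →⋆ₙₐ[ℂ] L × C := j.prod πB
  have hfst (e : StarPoly A B) : (e.eval f g).1 = e.eval i j :=
    map_eval (NonUnitalStarAlgHom.fst ℂ L C) f g e
  have hsnd (e : StarPoly A B) : (e.eval f g).2 = e.eval πA πB :=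
    map_eval (NonUnitalStarAlgHom.snd ℂ L C) f g e
  have hbound (z : L × C) (hz : z ∈ gen f g) : ‖z.2‖ ≤ ‖z.1‖ := by
    have hc : IsClosed {z : L × C | ‖z.2‖ ≤ ‖z.1‖} :=
      isClosed_le (by fun_prop) (by fun_prop)
    refine closure_minimal (fun w hw => ?_) hc hz
    obtain ⟨e, rfl⟩ := exists_starPoly f g w hw
    change ‖(e.eval f g).2‖ ≤ ‖(e.eval f g).1‖
    rw [hfst, hsnd]
    exact h e
  have hmem (z : L × C) (hz : z ∈ gen f g) : z.1 ∈ gen i j := by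
    refine map_mem_closure continuous_fst hz fun w hw => ?_
    obtain ⟨e, rfl⟩ := exists_starPoly f g w hw
    rw [hfst]
    exact eval_mem _ _ e
  let q : gen f g →⋆ₙₐ[ℂ] L :=
    (NonUnitalStarAlgHom.fst ℂ L C).comp (NonUnitalStarSubalgebraClass.subtype (gen f g))
  have hq : Function.Injective q := by
    intro z w hzw
    have h1 := hbound (z - w).1 (z - w).2
    have h2 : (z - w).1.1 = 0 := sub_eq_zero.2 hzw
    rw [h2, norm_zero, norm_le_zero_iff] at h1
    exact Subtype.ext (Prod.ext hzw (sub_eq_zero.1 h1))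
  have hcl : IsClosed (Set.range q) :=
    (NonUnitalStarAlgHom.isometry q hq).isClosedEmbedding.isClosed_range
  let p : gen f g →⋆ₙₐ[ℂ] gen i j :=
    NonUnitalStarAlgHom.codRestrict q (gen i j) fun z => hmem z.1 z.2
  have hp : Function.Bijective p := by
    refine ⟨fun z w hzw => hq (congrArg Subtype.val hzw), fun ⟨x, hx⟩ => ?_⟩
    have hx' : x ∈ Set.range q := by
      refine closure_minimal (fun w hw => ?_) hcl hx
      obtain ⟨e, rfl⟩ := exists_starPoly _ _ w hw
      exact ⟨⟨e.eval f g, NonUnitalStarSubalgebra.le_topologicalClosure _ (eval_mem f g e)⟩,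
        hfst e⟩
    obtain ⟨z, hz⟩ := hx'
    exact ⟨z, Subtype.ext hz⟩
  let P := StarAlgEquiv.ofBijective (R := ℂ) p hp
  let r : gen f g →⋆ₙₐ[ℂ] C :=
    (NonUnitalStarAlgHom.snd ℂ L C).comp (NonUnitalStarSubalgebraClass.subtype (gen f g))
  refine ⟨r.comp (P.symm : gen i j →⋆ₙₐ[ℂ] gen f g), fun a => ?_, fun b => ?_⟩
  · have : P.symm ⟨i a, inl_mem_gen i j a⟩ = ⟨f a, inl_mem_gen f g a⟩ :=
      P.symm_apply_apply ⟨f a, inl_mem_gen f g a⟩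
    change (P.symm ⟨i a, inl_mem_gen i j a⟩).1.2 = πA a
    rw [this]
    rfl
  · have : P.symm ⟨j b, inr_mem_gen i j b⟩ = ⟨g b, inr_mem_gen f g b⟩ :=
      P.symm_apply_apply ⟨g b, inr_mem_gen f g b⟩
    change (P.symm ⟨j b, inr_mem_gen i j b⟩).1.2 = πB b
    rw [this]
    rfl

/-- The full amalgamated free product C⋆-algebra `A *_D B`: the C⋆-algebra generated by `A` and `B`
under the norm that is the supremum over all pairs of `*`-homomorphisms agreeing on `D`. -/
def FreeProd : Type u := gen (inlBig φA φB) (inrBig φA φB)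

instance : NonUnitalCStarAlgebra (FreeProd φA φB) :=
  inferInstanceAs (NonUnitalCStarAlgebra (gen (inlBig φA φB) (inrBig φA φB)))

/-- The inclusion of `A *_D B` in the bounded product. -/
def val : FreeProd φA φB →⋆ₙₐ[ℂ] BigProd φA φB :=
  NonUnitalStarSubalgebraClass.subtype (gen (inlBig φA φB) (inrBig φA φB))

/-- The canonical map `σ_A : A → A *_D B`. -/
def inl : A →⋆ₙₐ[ℂ] FreeProd φA φB :=
  NonUnitalStarAlgHom.codRestrict (inlBig φA φB) (gen (inlBig φA φB) (inrBig φA φB))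
    (inl_mem_gen _ _)

/-- The canonical map `σ_B : B → A *_D B`. -/
def inr : B →⋆ₙₐ[ℂ] FreeProd φA φB :=
  NonUnitalStarAlgHom.codRestrict (inrBig φA φB) (gen (inlBig φA φB) (inrBig φA φB))
    (inr_mem_gen _ _)

theorem inl_comp_eq : (inl φA φB).comp φA = (inr φA φB).comp φB := by
  ext d
  apply Subtype.ext
  apply lp.ext
  funext i
  exact DFunLike.congr_fun (rep φA φB i).compat d

lemma eval_apply (i : Idx φA φB) (e : StarPoly A B) :
    (e.eval (inlBig φA φB) (inrBig φA φB)) i = e.eval (rep φA φB i).πA (rep φA φB i).πB := by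
  induction e with
  | inl a => rfl
  | inr b => rfl
  | add x y hx hy => simp [StarPoly.eval, hx, hy]
  | mul x y hx hy => simp [StarPoly.eval, hx, hy]
  | smul c x hx => simp [StarPoly.eval, hx]
  | star x hx => simp [StarPoly.eval, hx]

lemma norm_eval_le (Q : CompatPair φA φB) (e : StarPoly A B) :
    ‖e.eval Q.πA Q.πB‖ ≤ ‖e.eval (inlBig φA φB) (inrBig φA φB)‖ := by
  have h := lp.norm_apply_le_norm ENNReal.top_ne_zero
    (e.eval (inlBig φA φB) (inrBig φA φB)) (⟨Q.normFn, Q, rfl⟩ : Idx φA φB)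
  rw [eval_apply] at h
  exact (congrFun (rep_spec φA φB ⟨Q.normFn, Q, rfl⟩) e).symm.le.trans h

/-- `A *_D B` is generated, as a C⋆-algebra, by the images of `A` and `B`. -/
theorem gen_inl_inr : gen (inl φA φB) (inr φA φB) = ⊤ := by
  rw [eq_top_iff]
  rintro x -
  refine Metric.mem_closure_iff.2 fun ε hε => ?_
  obtain ⟨y, hy, hxy⟩ := Metric.mem_closure_iff.1 x.2 ε hε
  obtain ⟨e, rfl⟩ := exists_starPoly _ _ y hy
  refine ⟨e.eval (inl φA φB) (inr φA φB), eval_mem _ _ e, ?_⟩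
  have h := map_eval (val φA φB) (inl φA φB) (inr φA φB) e
  have h' : dist x (e.eval (inl φA φB) (inr φA φB)) =
      dist (val φA φB x) (val φA φB (e.eval (inl φA φB) (inr φA φB))) := rfl
  rw [h', h]
  exact hxy

/-- The existence part of the universal property. -/
theorem exists_lift {C : Type u} [NonUnitalCStarAlgebra C] (πA : A →⋆ₙₐ[ℂ] C)
    (πB : B →⋆ₙₐ[ℂ] C) (h : πA.comp φA = πB.comp φB) :
    ∃ π : FreeProd φA φB →⋆ₙₐ[ℂ] C,
      π.comp (inl φA φB) = πA ∧ π.comp (inr φA φB) = πB := by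
  obtain ⟨π, hl, hr⟩ := exists_hom_of_norm_le (inlBig φA φB) (inrBig φA φB) πA πB
    (norm_eval_le φA φB ⟨C, πA, πB, h⟩)
  exact ⟨π, NonUnitalStarAlgHom.ext hl, NonUnitalStarAlgHom.ext hr⟩

/-- A `*`-homomorphism on `A *_D B` is determined by its restrictions to `A` and `B`. -/
theorem hom_ext {C : Type u} [NonUnitalCStarAlgebra C] {π π' : FreeProd φA φB →⋆ₙₐ[ℂ] C}
    (hl : π.comp (inl φA φB) = π'.comp (inl φA φB))
    (hr : π.comp (inr φA φB) = π'.comp (inr φA φB)) : π = π' := by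
  ext x
  have hx : x ∈ gen (inl φA φB) (inr φA φB) := by
    rw [gen_inl_inr]
    exact NonUnitalStarAlgebra.mem_top
  have hc : IsClosed {x | π x = π' x} :=
    isClosed_eq (continuous_starHom π) (continuous_starHom π')
  refine closure_minimal (fun w hw => ?_) hc hx
  obtain ⟨e, rfl⟩ := exists_starPoly _ _ w hw
  change π _ = π' _
  rw [map_eval, map_eval]
  congr 1
  · exact funext fun a => DFunLike.congr_fun hl a
  · exact funext fun b => DFunLike.congr_fun hr b

/-- The `*`-homomorphism on `A *_D B` given by the universal property. -/
def lift {C : Type u} [NonUnitalCStarAlgebra C] (πA : A →⋆ₙₐ[ℂ] C)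
    (πB : B →⋆ₙₐ[ℂ] C) (h : πA.comp φA = πB.comp φB) : FreeProd φA φB →⋆ₙₐ[ℂ] C :=
  (exists_lift φA φB πA πB h).choose

theorem lift_comp_inl {C : Type u} [NonUnitalCStarAlgebra C] (πA : A →⋆ₙₐ[ℂ] C)
    (πB : B →⋆ₙₐ[ℂ] C) (h : πA.comp φA = πB.comp φB) :
    (lift φA φB πA πB h).comp (inl φA φB) = πA :=
  (exists_lift φA φB πA πB h).choose_spec.1

theorem lift_comp_inr {C : Type u} [NonUnitalCStarAlgebra C] (πA : A →⋆ₙₐ[ℂ] C)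
    (πB : B →⋆ₙₐ[ℂ] C) (h : πA.comp φA = πB.comp φB) :
    (lift φA φB πA πB h).comp (inr φA φB) = πB :=
  (exists_lift φA φB πA πB h).choose_spec.2

variable {A' B' D' : Type u} [NonUnitalCStarAlgebra A'] [NonUnitalCStarAlgebra B']
  [NonUnitalCStarAlgebra D']

/-- The `*`-homomorphism `A *_D B → A' *_D' B'` arising via the universal property from compatible
`*`-homomorphisms `A → A'`, `D → D'` and `B → B'`. -/
def map (φA' : D' →⋆ₙₐ[ℂ] A') (φB' : D' →⋆ₙₐ[ℂ] B') (lA : A →⋆ₙₐ[ℂ] A')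
    (lD : D →⋆ₙₐ[ℂ] D') (lB : B →⋆ₙₐ[ℂ] B') (hA : lA.comp φA = φA'.comp lD)
    (hB : lB.comp φB = φB'.comp lD) : FreeProd φA φB →⋆ₙₐ[ℂ] FreeProd φA' φB' :=
  lift φA φB ((inl φA' φB').comp lA) ((inr φA' φB').comp lB) <| by
    rw [NonUnitalStarAlgHom.comp_assoc, hA, ← NonUnitalStarAlgHom.comp_assoc, inl_comp_eq,
      NonUnitalStarAlgHom.comp_assoc, ← hB, ← NonUnitalStarAlgHom.comp_assoc]

/-- `e` is a two-sided multiplicative identity of `A`. -/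
def IsIdentity (e : A) : Prop := ∀ a : A, e * a = a ∧ a * e = a

/-- `D = ℂ`, `A` and `B` are unital, and the inclusions of `D` in `A` and `B` are unital. -/
def IsUnitalScalar : Prop :=
  ∃ e : ℂ ≃⋆ₐ[ℂ] D, IsIdentity (φA (e 1)) ∧ IsIdentity (φB (e 1))

end CStarAmalgam

end

/-! Write `a₁' = a₁ d` and `a₂' = d a₂`. In the larger free product `d` can be moved across `b`, so
`a₁' b a₂` and `a₁ b a₂'` have the same image under `map`. The work is to show that they differ in
`A *_D B` (`mul_inr_mul_ne`). For this, take representations `R` of `A` and `Q` of `B` in which `D`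
acts by the same scalars. On the tensor product of the two spaces let `A` act by `R ⊗ 1` and `B` by
`W (1 ⊗ Q) W*`, with `W` any unitary. Conjugation fixes scalars, so the pair is compatible and
extends to the free product. If the two words were equal, then `R(a₁') y R(a₂) = R(a₁) y R(a₂')` for
every conjugate `y` of `1 ⊗ Q(b)`. This condition is linear in `y`, so it passes to the off-diagonal
corners in the span of the conjugates (`corner_mem`). The corner at a unit vector `f ⊗ e` has rank
at most one. It violates the condition (`exists_unitary_notMem`) once `R(a₁') f` is no multiple of
`R(a₁) f`, `R(a₂)* f ≠ 0`, and `e` is no eigenvector of `Q(b)*`. GNS representations and direct sums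
supply such vectors. -/

noncomputable section

open scoped InnerProductSpace TensorProduct ComplexOrder

namespace CStarAmalgam

/-! ### Positive functionals by convex separation. -/

section Separation

variable {A : Type u} [NonUnitalCStarAlgebra A]

/-- For `a ≠ 0`, some positive functional does not vanish on `star a * a`. -/
theorem exists_positive_functional [PartialOrder A] [StarOrderedRing A] (a : A) (ha : a ≠ 0) :
    ∃ f : A →ₚ[ℂ] ℂ, f (star a * a) ≠ 0 := by
  let K : ProperCone ℝ A :=
    { carrier := {x | 0 ≤ x}
      add_mem' := fun hx hy => add_nonneg hx hy
      zero_mem' := le_rfl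
      smul_mem' := fun c x hx => smul_nonneg c.2 hx
      isClosed' := CStarAlgebra.isClosed_nonneg }
  have hpos : (0 : A) ≤ star a * a := star_mul_self_nonneg a
  have hK : -(star a * a) ∉ K := fun h => by
    have h0 : star a * a = 0 := le_antisymm (neg_nonneg.1 h) hpos
    exact ha (CStarRing.star_mul_self_eq_zero_iff a |>.1 h0)
  obtain ⟨f, hf, hfa⟩ := K.hyperplane_separation_point hK
  -- Separation yields a merely real-linear `f`. Complexifying `f ∘ Re` gives a complex-linear
  -- functional that agrees with `f` on positive elements.
  let g : A →ₗ[ℂ] ℂ := Module.Dual.extendRCLike (𝕜 := ℂ)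
    ((f : A →ₗ[ℝ] ℝ) ∘ₗ (selfAdjoint.submodule ℝ A).subtype ∘ₗ realPart)
  have hg : ∀ x : A, 0 ≤ x → g x = f x := fun x hx => by
    have hx' : IsSelfAdjoint x := IsSelfAdjoint.of_nonneg hx
    have h1 : ((realPart x : selfAdjoint A) : A) = x := hx'.coe_realPart
    have h2 : ((realPart (Complex.I • x) : selfAdjoint A) : A) = 0 := by
      rw [realPart_I_smul, hx'.imaginaryPart]
      simp
    simp only [g, Module.Dual.extendRCLike_apply, LinearMap.comp_apply]
    change ((f ((realPart x : selfAdjoint A) : A) : ℝ) : ℂ) - Complex.I *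
      ((f ((realPart (Complex.I • x) : selfAdjoint A) : A) : ℝ) : ℂ) = _
    rw [h1, h2]
    simp
  refine ⟨PositiveLinearMap.mk₀ g fun x hx => ?_, ?_⟩
  · rw [hg x hx]
    exact_mod_cast hf x hx
  · change g (star a * a) ≠ 0
    rw [hg _ hpos]
    rw [map_neg, neg_lt_zero] at hfa
    exact_mod_cast hfa.ne'

end Separation

/-! ### GNS representations and their direct sums. -/

/-- A `*`-representation of a C⋆-algebra on a Hilbert space. -/
structure HilbertRep (A : Type u) [NonUnitalCStarAlgebra A] : Type (u + 1) where
  H : Type u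
  [normedAddCommGroup : NormedAddCommGroup H]
  [innerProductSpace : InnerProductSpace ℂ H]
  [completeSpace : CompleteSpace H]
  π : A →⋆ₙₐ[ℂ] (H →L[ℂ] H)

attribute [instance] HilbertRep.normedAddCommGroup HilbertRep.innerProductSpace
  HilbertRep.completeSpace

namespace HilbertRep

variable {A : Type u} [NonUnitalCStarAlgebra A]

/-- A representation is unital if it maps an identity, should there be one, to the identity. -/
def IsUnital (R : HilbertRep A) : Prop := ∀ e : A, IsIdentity e → R.π e = 1

/-- GNS for a functional `f` that does not vanish on `(a a*)* (a a*)`. Without a unit there is no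
evident cyclic vector, so the class of `a*` is used: `a` sends it to the class of `a a*`, which has
nonzero norm. -/
theorem exists_apply_ne_zero (a : A) (ha : a ≠ 0) :
    ∃ R : HilbertRep A, R.IsUnital ∧ ∃ ξ : R.H, R.π a ξ ≠ 0 := by
  let _ : PartialOrder A := CStarAlgebra.spectralOrder A
  let _ : StarOrderedRing A := CStarAlgebra.spectralOrderedRing A
  have haa : a * star a ≠ 0 := fun h => ha (CStarRing.mul_star_self_eq_zero_iff a |>.1 h)
  obtain ⟨f, hf⟩ := exists_positive_functional (a * star a) haa
  refine ⟨⟨f.GNS, f.gnsNonUnitalStarAlgHom⟩, fun e he => ?_,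
    (f.toPreGNS (star a) : f.GNS), fun h => hf ?_⟩
  · ext x
    change f.gnsNonUnitalStarAlgHom e x = x
    induction x using UniformSpace.Completion.induction_on with
    | hp => exact isClosed_eq (by fun_prop) (by fun_prop)
    | ih x =>
      rw [PositiveLinearMap.gnsNonUnitalStarAlgHom_apply_coe,
        PositiveLinearMap.leftMulMapPreGNS_apply, (he _).1]
      rfl
  · change f.gnsNonUnitalStarAlgHom a (f.toPreGNS (star a) : f.GNS) = 0 at h
    rw [PositiveLinearMap.gnsNonUnitalStarAlgHom_apply_coe] at h
    have h2 := f.preGNS_norm_sq (f.toPreGNS (a * star a))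
    have h3 : ‖f.toPreGNS (a * star a)‖ = 0 := by
      rw [← UniformSpace.Completion.norm_coe]
      exact norm_eq_zero.2 h
    rw [h3] at h2
    simpa using h2.symm

end HilbertRep

section DirectSum

variable {E F : Type u} [NormedAddCommGroup E] [InnerProductSpace ℂ E]
  [NormedAddCommGroup F] [InnerProductSpace ℂ F]

/-- The diagonal operator on the Hilbert sum of two spaces. -/
def diagOp (S : E →L[ℂ] E) (T : F →L[ℂ] F) : WithLp 2 (E × F) →L[ℂ] WithLp 2 (E × F) :=
  (WithLp.prodContinuousLinearEquiv 2 ℂ E F).symm.toContinuousLinearMap ∘L S.prodMap T ∘L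
    (WithLp.prodContinuousLinearEquiv 2 ℂ E F).toContinuousLinearMap

theorem diagOp_apply (S : E →L[ℂ] E) (T : F →L[ℂ] F) (x : WithLp 2 (E × F)) :
    diagOp S T x = WithLp.toLp 2 (S x.fst, T x.snd) := rfl

end DirectSum

namespace HilbertRep

variable {A : Type u} [NonUnitalCStarAlgebra A]

/-- The direct sum of two representations. -/
def sum (R S : HilbertRep A) : HilbertRep A where
  H := WithLp 2 (R.H × S.H)
  π :=
    { toFun a := diagOp (R.π a) (S.π a)
      map_smul' c a := by
        ext x
        simp only [diagOp_apply, map_smul]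
        rfl
      map_zero' := by ext x; all_goals simp [diagOp_apply]
      map_add' a b := by
        ext x
        simp only [diagOp_apply, map_add]
        rfl
      map_mul' a b := by ext x; all_goals simp [diagOp_apply]
      map_star' a := by
        rw [ContinuousLinearMap.star_eq_adjoint, ContinuousLinearMap.eq_adjoint_iff]
        intro x y
        simp only [diagOp_apply, WithLp.prod_inner_apply, map_star,
          ContinuousLinearMap.star_eq_adjoint, ContinuousLinearMap.adjoint_inner_left]
        rfl }

theorem IsUnital.sum {R S : HilbertRep A} (hR : R.IsUnital) (hS : S.IsUnital) :
    (R.sum S).IsUnital := by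
  intro e he
  change diagOp (R.π e) (S.π e) = 1
  rw [hR e he, hS e he]
  rfl

end HilbertRep

/-! ### Hilbert space tensor products and amplified operators. -/

section Tensor

variable (E F : Type u) [NormedAddCommGroup E] [InnerProductSpace ℂ E]
  [NormedAddCommGroup F] [InnerProductSpace ℂ F]

/-- The Hilbert space tensor product. -/
abbrev HTensor : Type u := UniformSpace.Completion (E ⊗[ℂ] F)

variable {E F}

theorem completion_ext {S T : HTensor E F →L[ℂ] HTensor E F}
    (h : ∀ x : E ⊗[ℂ] F, S x = T x) : S = T := by
  ext x
  induction x using UniformSpace.Completion.induction_on with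
  | hp => exact isClosed_eq (by fun_prop) (by fun_prop)
  | ih x => exact h x

theorem completion_adjoint {S T : E ⊗[ℂ] F →L[ℂ] E ⊗[ℂ] F}
    (h : ∀ x y, ⟪S x, y⟫_ℂ = ⟪x, T y⟫_ℂ) : S.completion = star T.completion := by
  rw [ContinuousLinearMap.star_eq_adjoint, ContinuousLinearMap.eq_adjoint_iff]
  intro x y
  induction x, y using UniformSpace.Completion.induction_on₂ with
  | hp => exact isClosed_eq (by fun_prop) (by fun_prop)
  | ih x y => simpa using h x y

theorem inner_map_left_eq {S T : E ⊗[ℂ] F →L[ℂ] E ⊗[ℂ] F}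
    (h : ∀ u v u' v', ⟪S (u ⊗ₜ v), u' ⊗ₜ v'⟫_ℂ = ⟪u ⊗ₜ v, T (u' ⊗ₜ v')⟫_ℂ)
    (x y : E ⊗[ℂ] F) : ⟪S x, y⟫_ℂ = ⟪x, T y⟫_ℂ := by
  induction x with
  | zero => simp
  | add x x' hx hx' => simp only [map_add, inner_add_left, hx, hx']
  | tmul u v =>
    induction y with
    | zero => simp
    | add y y' hy hy' => simp only [map_add, inner_add_right, hy, hy']
    | tmul u' v' => exact h u v u' v'

/-- The amplification `S ↦ S ⊗ 1`. -/
def ampLeft [CompleteSpace E] : (E →L[ℂ] E) →⋆ₙₐ[ℂ] (HTensor E F →L[ℂ] HTensor E F) where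
  toFun S := (S.rTensor F).completion
  map_smul' c S := completion_ext fun x => by simp
  map_zero' := completion_ext fun x => by simp
  map_add' S T := completion_ext fun x => by simp [UniformSpace.Completion.coe_add]
  map_mul' S T := completion_ext fun x => by simp [ContinuousLinearMap.rTensor_mul]
  map_star' S := completion_adjoint <| inner_map_left_eq fun u v u' v' => by
    simp [ContinuousLinearMap.star_eq_adjoint,
      ContinuousLinearMap.adjoint_inner_left]

/-- The amplification `T ↦ 1 ⊗ T`. -/
def ampRight [CompleteSpace F] : (F →L[ℂ] F) →⋆ₙₐ[ℂ] (HTensor E F →L[ℂ] HTensor E F) where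
  toFun S := (S.lTensor E).completion
  map_smul' c S := completion_ext fun x => by simp
  map_zero' := completion_ext fun x => by simp
  map_add' S T := completion_ext fun x => by simp [UniformSpace.Completion.coe_add]
  map_mul' S T := completion_ext fun x => by simp [ContinuousLinearMap.lTensor_mul]
  map_star' S := completion_adjoint <| inner_map_left_eq fun u v u' v' => by
    simp [ContinuousLinearMap.star_eq_adjoint,
      ContinuousLinearMap.adjoint_inner_left]

theorem ampLeft_tmul [CompleteSpace E] (S : E →L[ℂ] E) (u : E) (v : F) :
    ampLeft S ((u ⊗ₜ[ℂ] v : E ⊗[ℂ] F) : HTensor E F) = ((S u ⊗ₜ[ℂ] v : E ⊗[ℂ] F) : HTensor E F) := by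
  change (S.rTensor F).completion _ = _
  simp

theorem ampRight_tmul [CompleteSpace F] (T : F →L[ℂ] F) (u : E) (v : F) :
    ampRight T ((u ⊗ₜ[ℂ] v : E ⊗[ℂ] F) : HTensor E F) =
      ((u ⊗ₜ[ℂ] T v : E ⊗[ℂ] F) : HTensor E F) := by
  change (T.lTensor E).completion _ = _
  simp

theorem ampLeft_one [CompleteSpace E] : ampLeft (1 : E →L[ℂ] E) = (1 : HTensor E F →L[ℂ] HTensor E F) :=
  completion_ext fun x => by
    change ((1 : E →L[ℂ] E).rTensor F).completion _ = _
    simp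

theorem ampRight_one [CompleteSpace F] : ampRight (1 : F →L[ℂ] F) = (1 : HTensor E F →L[ℂ] HTensor E F) :=
  completion_ext fun x => by
    change ((1 : F →L[ℂ] F).lTensor E).completion _ = _
    simp

/-- Operators on two Hilbert spaces act jointly on a Hilbert space generated by tensors. -/
theorem exists_tensor (E F : Type u) [NormedAddCommGroup E] [InnerProductSpace ℂ E]
    [CompleteSpace E] [NormedAddCommGroup F] [InnerProductSpace ℂ F] [CompleteSpace F] :
    ∃ (K : Type u) (_ : NormedAddCommGroup K) (_ : InnerProductSpace ℂ K) (_ : CompleteSpace K)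
      (α : (E →L[ℂ] E) →⋆ₙₐ[ℂ] (K →L[ℂ] K)) (β : (F →L[ℂ] F) →⋆ₙₐ[ℂ] (K →L[ℂ] K))
      (m : E →ₗ[ℂ] F →ₗ[ℂ] K), α 1 = 1 ∧ β 1 = 1 ∧
      (∀ u v u' v', ⟪m u v, m u' v'⟫_ℂ = ⟪u, u'⟫_ℂ * ⟪v, v'⟫_ℂ) ∧
      (∀ S u v, α S (m u v) = m (S u) v) ∧ ∀ T u v, β T (m u v) = m u (T v) :=
  ⟨HTensor E F, inferInstance, inferInstance, inferInstance, ampLeft, ampRight,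
    (TensorProduct.mk ℂ E F).compr₂ (UniformSpace.Completion.toComplₗᵢ (𝕜 := ℂ)).toLinearMap,
    ampLeft_one, ampRight_one, fun u v u' v' => by simp, fun S u v => ampLeft_tmul S u v,
    fun T u v => ampRight_tmul T u v⟩

end Tensor

/-! ### Unitary conjugates and the corners they span. -/

section Conjugation

variable {M : Type*} [CStarAlgebra M]

/-- Conjugation by a unitary. -/
def conj (W : unitary M) : M →⋆ₙₐ[ℂ] M where
  toFun x := W * x * star (W : M)
  map_smul' c x := by simp
  map_zero' := by simp
  map_add' x y := by simp [mul_add, add_mul]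
  map_mul' x y := by
    have : star (W : M) * W = 1 := Unitary.coe_star_mul_self W
    simp only [mul_assoc]
    rw [← mul_assoc (star (W : M)) W, this, one_mul]
  map_star' x := by simp [mul_assoc]

theorem conj_one (W : unitary M) : conj W 1 = 1 := by
  simp [conj]

/-- `1 - (1 - z) P` is unitary, for a projection `P` and a number `z` of modulus one. -/
def reflection {P : M} (hP : IsStarProjection P) (z : ℂ) (hz : star z * z = 1) : unitary M :=
  ⟨1 - (1 - z) • P, by
    have hs : star P = P := hP.isSelfAdjoint
    have hi : P * P = P := hP.isIdempotentElem
    have key (s t : ℂ) (h : s * t = 1) :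
        (1 - (1 - s) • P) * (1 - (1 - t) • P) = 1 := by
      rw [sub_mul, one_mul, mul_sub, mul_one, smul_mul_smul_comm, hi]
      have : (1 - s) * (1 - t) = (1 - s) + (1 - t) := by linear_combination h
      rw [this, add_smul]
      abel
    rw [Unitary.mem_iff]
    simp only [star_sub, star_one, star_smul, hs]
    exact ⟨key _ _ hz, key _ _ (by rw [mul_comm]; exact hz)⟩⟩

theorem conj_reflection {P : M} (hP : IsStarProjection P) (z : ℂ) (hz : star z * z = 1) (x : M) :
    conj (reflection hP z hz) x =
      x - (1 - z) • (P * x) - (1 - star z) • (x * P) + ((1 - z) * (1 - star z)) • (P * x * P) := by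
  have hs : star P = P := hP.isSelfAdjoint
  change (1 - (1 - z) • P) * x * star (1 - (1 - z) • P) = _
  rw [star_sub, star_one, star_smul, hs, star_sub, star_one, mul_sub, mul_one, sub_mul, one_mul,
    sub_mul, smul_mul_assoc, mul_smul_comm, smul_mul_smul_comm]
  abel

/-- A subspace that contains all unitary conjugates of `x` contains its off-diagonal corners. -/
theorem corner_mem (N : Submodule ℂ M) (x : M) (hN : ∀ W : unitary M, conj W x ∈ N) {P : M}
    (hP : IsStarProjection P) : P * x * (1 - P) ∈ N := by
  -- Conjugation by `zP + (1 - P)` multiplies the corner `P x (1 - P)` by `z`, its opposite by `star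
  -- z`, and fixes the diagonal blocks. Averaging `star z` times the conjugate over the fourth roots
  -- of unity `z` isolates the first corner.
  have h0 := hN 1
  have hI := hN (reflection hP Complex.I (by simp))
  have hI' := hN (reflection hP (-Complex.I) (by simp))
  have h1 := hN (reflection hP (-1) (by simp))
  rw [conj_reflection] at hI hI' h1
  have h0' : conj (1 : unitary M) x = x := by simp [conj]
  rw [h0'] at h0
  have := N.add_mem (N.smul_mem (1 / 4 : ℂ) (N.sub_mem h0 h1))
    (N.smul_mem (1 / (4 * Complex.I) : ℂ) (N.sub_mem hI hI'))
  convert this using 1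
  rw [mul_sub, mul_one]
  simp only [star_neg, star_one, Complex.star_def, Complex.conj_I]
  match_scalars <;> field_simp <;> ring_nf

/-- The space of all `y` with `s' * y * t = s * y * t'`. -/
def coincidence (s s' t t' : M) : Submodule ℂ M where
  carrier := {y | s' * y * t = s * y * t'}
  add_mem' {x y} hx hy := by
    simp only [Set.mem_ofPred_eq] at hx hy ⊢
    simp only [mul_add, add_mul, hx, hy]
  zero_mem' := by simp
  smul_mem' c x hx := by
    simp only [Set.mem_ofPred_eq] at hx ⊢
    simp only [mul_smul_comm, smul_mul_assoc, hx]

end Conjugation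

/-! ### The rank-one argument on the tensor product. -/

section Tensor

variable {E F K : Type u} [NormedAddCommGroup E] [InnerProductSpace ℂ E] [CompleteSpace E]
  [NormedAddCommGroup F] [InnerProductSpace ℂ F] [CompleteSpace F]
  [NormedAddCommGroup K] [InnerProductSpace ℂ K] [CompleteSpace K]

theorem rankOne_corner_mem (N : Submodule ℂ (K →L[ℂ] K)) (x : K →L[ℂ] K)
    (hN : ∀ W : unitary (K →L[ℂ] K), conj W x ∈ N) (g : K) (hg : ‖g‖ = 1) :
    ∃ y ∈ N, ∀ z : K, y z = ⟪g, x (z - ⟪g, z⟫_ℂ • g)⟫_ℂ • g :=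
  ⟨_, corner_mem N x hN (InnerProductSpace.isStarProjection_rankOne_self (𝕜 := ℂ) hg), fun z => by
    simp [InnerProductSpace.rankOne_apply, inner_sub_right, inner_smul_right]⟩

theorem apply_eq_of_mem_coincidence (s s' t t' y : K →L[ℂ] K)
    (h : y ∈ coincidence s s' t t') (z : K) : s' (y (t z)) = s (y (t' z)) :=
  congrArg (fun Z : K →L[ℂ] K => Z z) h

/-- If `S' f` is no multiple of `S f` and `e` is no eigenvector of `star X`, then some unitary
conjugate of `1 ⊗ X` distinguishes `S' y T` from `S y T'`. -/
theorem exists_unitary_notMem (α : (E →L[ℂ] E) →⋆ₙₐ[ℂ] (K →L[ℂ] K))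
    (β : (F →L[ℂ] F) →⋆ₙₐ[ℂ] (K →L[ℂ] K)) (m : E →ₗ[ℂ] F →ₗ[ℂ] K)
    (hm : ∀ u v u' v', ⟪m u v, m u' v'⟫_ℂ = ⟪u, u'⟫_ℂ * ⟪v, v'⟫_ℂ)
    (hα : ∀ S u v, α S (m u v) = m (S u) v) (hβ : ∀ T u v, β T (m u v) = m u (T v))
    (S S' T T' : E →L[ℂ] E) (X : F →L[ℂ] F) (f : E) (e : F)
    (hS : ∀ k : ℂ, S' f ≠ k • S f) (hT : star T f ≠ 0) (hX : ∀ k : ℂ, star X e ≠ k • e) :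
    ∃ W : unitary (K →L[ℂ] K),
      conj W (β X) ∉ coincidence (α S) (α S') (α T) (α T') := by
  wlog hn : ‖f‖ = 1 ∧ ‖e‖ = 1 generalizing f e
  · have hf : f ≠ 0 := fun h => hT (by rw [h, map_zero])
    have he : e ≠ 0 := fun h => hX 0 (by rw [h, map_zero, smul_zero])
    have hf' : (‖f‖⁻¹ : ℂ) ≠ 0 := by simpa using hf
    have he' : (‖e‖⁻¹ : ℂ) ≠ 0 := by simpa using he
    refine this ((‖f‖⁻¹ : ℂ) • f) ((‖e‖⁻¹ : ℂ) • e) (fun k h => hS k ?_) (fun h => hT ?_)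
      (fun k h => hX k ?_) ⟨by simp [norm_smul, hf], by simp [norm_smul, he]⟩
    · rw [map_smul, map_smul, smul_comm] at h
      exact smul_right_injective E hf' h
    · rw [map_smul] at h
      exact (smul_eq_zero.1 h).resolve_left hf'
    · rw [map_smul, smul_comm] at h
      exact smul_right_injective F he' h
  obtain ⟨hf, he⟩ := hn
  by_contra! hW
  have hff : ⟪f, f⟫_ℂ = 1 := by simp [inner_self_eq_norm_sq_to_K, hf]
  have hee : ⟪e, e⟫_ℂ = 1 := by simp [inner_self_eq_norm_sq_to_K, he]
  have hg : ‖m f e‖ = 1 := by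
    rw [norm_eq_sqrt_re_inner (𝕜 := ℂ), hm, hff, hee]
    simp
  obtain ⟨y, hy, hyg⟩ := rankOne_corner_mem _ (β X) hW (m f e) hg
  -- Both sides of the coincidence at `z` lie in `E ⊗ e`: one is a multiple of `S' f ⊗ e`, the other
  -- of `S f ⊗ e`. By `hS` the coefficient of the former vanishes.
  have hzero (z : K) : ⟪m f e, β X (α T z - ⟪m f e, α T z⟫_ℂ • m f e)⟫_ℂ = 0 := by
    have h := apply_eq_of_mem_coincidence _ _ _ _ _ hy z
    rw [hyg, hyg, map_smul, map_smul, hα, hα] at h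
    by_contra hne
    set c := ⟪m f e, β X (α T z - ⟪m f e, α T z⟫_ℂ • m f e)⟫_ℂ
    set c' := ⟪m f e, β X (α T' z - ⟪m f e, α T' z⟫_ℂ • m f e)⟫_ℂ
    have h0 : m (c • S' f - c' • S f) e = 0 := by simp [h]
    have h1 := hm (c • S' f - c' • S f) e (c • S' f - c' • S f) e
    rw [h0, inner_zero_left, hee, mul_one] at h1
    have h2 := sub_eq_zero.1 (inner_self_eq_zero.1 h1.symm)
    apply hS (c⁻¹ * c')
    rw [mul_smul, ← h2, inv_smul_smul₀ hne]
  apply hX (star ⟪e, X e⟫_ℂ)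
  refine ext_inner_right ℂ fun v => ?_
  -- At `z = T* f ⊗ v` everything carries the factor `⟪f, T T* f⟫ = ‖T* f‖² ≠ 0`. Cancelling it
  -- leaves `⟪e, X v⟫ = ⟪e, v⟫ ⟪e, X e⟫` for all `v`, so `e` is an eigenvector of `X*`.
  have h := hzero (m (star T f) v)
  simp only [map_sub, map_smul, hα, hβ, inner_sub_right, inner_smul_right, hm] at h
  have hne : ⟪f, T (star T f)⟫_ℂ ≠ 0 := by
    rw [← ContinuousLinearMap.adjoint_inner_left, ← ContinuousLinearMap.star_eq_adjoint]
    exact inner_self_ne_zero.2 hT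
  rw [ContinuousLinearMap.star_eq_adjoint, ContinuousLinearMap.adjoint_inner_left,
    inner_smul_left]
  apply mul_left_cancel₀ hne
  rw [hff] at h
  simp only [Complex.star_def, Complex.conj_conj]
  linear_combination h

end Tensor

/-! ### Representations with vectors in general position. -/

section Vectors

variable {A : Type u} [NonUnitalCStarAlgebra A]

/-- If `a' f₂ = k₀ a f₂` with `a f₂ ≠ 0`, add a summand in which `a' - k₀ a` does not kill `f₃`. The
first component then forces the factor `k₀` and the second forbids it. One more summand takes care
of `c`. -/
theorem exists_rep_independent (a a' c : A) (ha0 : a ≠ 0) (ha : ∀ k : ℂ, a' ≠ k • a)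
    (hc : c ≠ 0) :
    ∃ R : HilbertRep A, R.IsUnital ∧ ∃ f : R.H,
      (∀ k : ℂ, R.π a' f ≠ k • R.π a f) ∧ R.π c f ≠ 0 := by
  obtain ⟨R₁, h₁, f₁, hf₁⟩ := HilbertRep.exists_apply_ne_zero c hc
  suffices h : ∃ R : HilbertRep A, R.IsUnital ∧ ∃ f : R.H,
      ∀ k : ℂ, R.π a' f ≠ k • R.π a f by
    obtain ⟨R, hR, f, hf⟩ := h
    refine ⟨R₁.sum R, h₁.sum hR, WithLp.toLp 2 (f₁, f), fun k h => hf k ?_, fun h => hf₁ ?_⟩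
    · exact congrArg WithLp.snd h
    · exact congrArg WithLp.fst h
  obtain ⟨R₂, h₂, f₂, hf₂⟩ := HilbertRep.exists_apply_ne_zero a ha0
  by_cases h : ∀ k : ℂ, R₂.π a' f₂ ≠ k • R₂.π a f₂
  · exact ⟨R₂, h₂, f₂, h⟩
  push Not at h
  obtain ⟨k₀, hk₀⟩ := h
  obtain ⟨R₃, h₃, f₃, hf₃⟩ := HilbertRep.exists_apply_ne_zero _ (sub_ne_zero.2 (ha k₀))
  refine ⟨R₂.sum R₃, h₂.sum h₃, WithLp.toLp 2 (f₂, f₃), fun k h => ?_⟩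
  have hfst : R₂.π a' f₂ = k • R₂.π a f₂ := congrArg WithLp.fst h
  have hsnd : R₃.π a' f₃ = k • R₃.π a f₃ := congrArg WithLp.snd h
  have hk : k₀ = k := smul_left_injective ℂ hf₂ (hk₀.symm.trans hfst)
  apply hf₃
  rw [map_sub, map_smul, sub_apply, hsnd, hk]
  exact sub_self _

theorem HilbertRep.sum_not_eigenvector (b : A) (R S : HilbertRep A) (f : R.H) (g : S.H)
    (hf : f ≠ 0) (k₀ : ℂ) (hR : R.π b f = k₀ • f) (hS : S.π b g ≠ k₀ • g) (k : ℂ) :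
    (R.sum S).π b (WithLp.toLp 2 (f, g)) ≠ k • WithLp.toLp 2 (f, g) := by
  intro h
  have hfst : R.π b f = k • f := congrArg WithLp.fst h
  have hsnd : S.π b g = k • g := congrArg WithLp.snd h
  exact hS (by rw [hsnd, smul_left_injective ℂ hf (hR.symm.trans hfst)])

/-- The zero representation serves as a summand with eigenvalue `0`. The result is not unital, so
even `b = 1` is covered; this is harmless when `D = 0`. -/
theorem exists_rep_not_eigenvector (b : A) (hb : b ≠ 0) :
    ∃ (S : HilbertRep A) (g : S.H), ∀ k : ℂ, S.π b g ≠ k • g := by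
  obtain ⟨R, -, f, hf⟩ := HilbertRep.exists_apply_ne_zero b hb
  have hf0 : f ≠ 0 := fun h => hf (by rw [h, map_zero])
  refine ⟨HilbertRep.sum ⟨R.H, 0⟩ R, WithLp.toLp 2 (f, f),
    HilbertRep.sum_not_eigenvector b ⟨R.H, 0⟩ R f f hf0 0 ?_ ?_⟩
  · rw [zero_smul]
    rfl
  · rwa [zero_smul]

/-- When `D = ℂ` the representation must be unital, which is why scalar multiples of the identity
are excluded. An eigenvalue `k₀` is defeated by a summand that detects `b - k₀ e`. -/
theorem exists_unital_rep_not_eigenvector (b e : A) (he : IsIdentity e)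
    (hb : ∀ k : ℂ, b ≠ k • e) :
    ∃ S : HilbertRep A, S.IsUnital ∧ ∃ g : S.H, ∀ k : ℂ, S.π b g ≠ k • g := by
  have hb0 : b ≠ 0 := fun h => hb 0 (by rw [h, zero_smul])
  obtain ⟨R, hR, f, hf⟩ := HilbertRep.exists_apply_ne_zero b hb0
  have hf0 : f ≠ 0 := fun h => hf (by rw [h, map_zero])
  by_cases h : ∀ k : ℂ, R.π b f ≠ k • f
  · exact ⟨R, hR, f, h⟩
  push Not at h
  obtain ⟨k₀, hk₀⟩ := h
  obtain ⟨S, hS, g, hg⟩ := HilbertRep.exists_apply_ne_zero _ (sub_ne_zero.2 (hb k₀))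
  refine ⟨R.sum S, hR.sum hS, _, HilbertRep.sum_not_eigenvector b R S f g hf0 k₀ hk₀ ?_⟩
  intro h
  apply hg
  rw [map_sub, map_smul, hS e he, sub_apply, h]
  exact sub_self _

end Vectors

/-! ### Separating the two words in the free product. -/

section FreeProduct

variable {A B D : Type u} [NonUnitalCStarAlgebra A] [NonUnitalCStarAlgebra B]
  [NonUnitalCStarAlgebra D] (φA : D →⋆ₙₐ[ℂ] A) (φB : D →⋆ₙₐ[ℂ] B)

theorem mul_inr_mul_ne_of_rep (R : HilbertRep A) (Q : HilbertRep B)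
    (hRQ : ∀ d : D, ∃ z : ℂ, R.π (φA d) = z • 1 ∧ Q.π (φB d) = z • 1)
    (a a' c c' : A) (b : B) (f : R.H) (e : Q.H) (hf : ∀ k : ℂ, R.π a' f ≠ k • R.π a f)
    (hc : R.π (star c) f ≠ 0) (he : ∀ k : ℂ, Q.π (star b) e ≠ k • e) :
    inl φA φB a' * inr φA φB b * inl φA φB c ≠ inl φA φB a * inr φA φB b * inl φA φB c' := by
  intro h
  obtain ⟨K, _, _, _, α, β, m, hα1, hβ1, hm, hα, hβ⟩ := exists_tensor R.H Q.H
  obtain ⟨W, hW⟩ := exists_unitary_notMem α β m hm hα hβ (R.π a) (R.π a') (R.π c) (R.π c')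
    (Q.π b) f e hf (by rwa [← map_star]) (by simpa only [← map_star] using he)
  apply hW
  have hcompat : (α.comp R.π).comp φA = (((conj W).comp β).comp Q.π).comp φB := by
    ext1 d
    obtain ⟨z, hzA, hzB⟩ := hRQ d
    change α (R.π (φA d)) = conj W (β (Q.π (φB d)))
    rw [hzA, hzB, map_smul, map_smul, map_smul, hα1, hβ1, conj_one]
  obtain ⟨π, hπA, hπB⟩ := exists_lift φA φB _ _ hcompat
  have hA (x : A) : π (inl φA φB x) = α (R.π x) := DFunLike.congr_fun hπA x
  have hB (x : B) : π (inr φA φB x) = conj W (β (Q.π x)) := DFunLike.congr_fun hπB x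
  have h' := congrArg π h
  rw [map_mul, map_mul, map_mul, map_mul, hA, hA, hA, hA, hB] at h'
  exact h'

theorem mul_inr_mul_ne (hD : (∀ x : D, x = 0) ∨ IsUnitalScalar φA φB) (a a' c c' : A) (b : B)
    (hb : b ∉ Set.range φB) (ha0 : a ≠ 0) (ha : ∀ k : ℂ, a' ≠ k • a) (hc : c ≠ 0) :
    inl φA φB a' * inr φA φB b * inl φA φB c ≠ inl φA φB a * inr φA φB b * inl φA φB c' := by
  obtain ⟨R, hR, f, hf, hfc⟩ := exists_rep_independent a a' (star c) ha0 ha (star_ne_zero.2 hc)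
  rcases hD with hD | ⟨ι, hιA, hιB⟩
  · have hb0 : star b ≠ 0 := star_ne_zero.2 fun h => hb ⟨0, by rw [h, map_zero]⟩
    obtain ⟨Q, e, he⟩ := exists_rep_not_eigenvector _ hb0
    refine mul_inr_mul_ne_of_rep φA φB R Q (fun d => ⟨0, ?_⟩) a a' c c' b f e hf hfc he
    simp [hD d]
  · have hι (z : ℂ) : ι z = z • ι 1 := by rw [← map_smul, smul_eq_mul, mul_one]
    -- Here the range of `φB` is exactly the scalar multiples of the identity of `B`, and it is
    -- closed under `star`.
    have hb' (k : ℂ) : star b ≠ k • φB (ι 1) := fun h => by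
      refine hb ⟨ι (star k), ?_⟩
      rw [← star_star b, h, star_smul, ← map_star φB, ← map_star ι, star_one, hι, map_smul]
    obtain ⟨Q, hQ, e, he⟩ := exists_unital_rep_not_eigenvector _ _ hιB hb'
    refine mul_inr_mul_ne_of_rep φA φB R Q (fun d => ⟨ι.symm d, ?_⟩) a a' c c' b f e hf hfc he
    have hd : d = ι.symm d • ι 1 := by rw [← hι, StarAlgEquiv.apply_symm_apply]
    constructor
    · conv_lhs => rw [hd, map_smul, map_smul, hR _ hιA]
    · conv_lhs => rw [hd, map_smul, map_smul, hQ _ hιB]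

end FreeProduct

end CStarAmalgam

end

/-! ### The two words have the same image. -/

open CStarAmalgam in
theorem proposition3p6 {A B D A' B' D' : Type u}
    [NonUnitalCStarAlgebra A] [NonUnitalCStarAlgebra B] [NonUnitalCStarAlgebra D]
    [NonUnitalCStarAlgebra A'] [NonUnitalCStarAlgebra B'] [NonUnitalCStarAlgebra D']
    (φA : D →⋆ₙₐ[ℂ] A) (φB : D →⋆ₙₐ[ℂ] B) (φA' : D' →⋆ₙₐ[ℂ] A') (φB' : D' →⋆ₙₐ[ℂ] B')
    (lA : A →⋆ₙₐ[ℂ] A') (lD : D →⋆ₙₐ[ℂ] D') (lB : B →⋆ₙₐ[ℂ] B')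
    (hφA : Function.Injective φA) (hφB : Function.Injective φB)
    (hφA' : Function.Injective φA') (hφB' : Function.Injective φB')
    (hlA : Function.Injective lA) (hlD : Function.Injective lD) (hlB : Function.Injective lB)
    (hA : lA.comp φA = φA'.comp lD) (hB : lB.comp φB = φB'.comp lD)
    (hD : (∀ x : D, x = 0) ∨ IsUnitalScalar φA φB)
    (hex : ∃ (d : D') (a₁ a₂ : A) (b : B),
      b ∉ Set.range φB ∧
      lA a₁ * φA' d ∈ Set.range lA ∧
      φA' d * lA a₂ ∈ Set.range lA ∧
      (∀ c : ℂ, lA a₁ * φA' d ≠ c • lA a₁) ∧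
      a₂ ≠ 0 ∧
      φB' d * lB b = lB b * φB' d) :
    ¬ Function.Injective (map φA φB φA' φB' lA lD lB hA hB) := by
  obtain ⟨d, a₁, a₂, b, hb, ⟨a₁', h₁⟩, ⟨a₂', h₂⟩, hne, ha₂, hcomm⟩ := hex
  intro hinj
  have ha₁ : a₁ ≠ 0 := fun h => hne 0 (by rw [h, map_zero, zero_mul, zero_smul])
  have ha₁' (k : ℂ) : a₁' ≠ k • a₁ := fun h => hne k (by rw [← h₁, h, map_smul])
  refine mul_inr_mul_ne φA φB hD a₁ a₁' a₂ a₂' b hb ha₁ ha₁' ha₂ (hinj ?_)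
  have hinl (x : A) : map φA φB φA' φB' lA lD lB hA hB (inl φA φB x) = inl φA' φB' (lA x) :=
    DFunLike.congr_fun (lift_comp_inl φA φB _ _ _) x
  have hinr (x : B) : map φA φB φA' φB' lA lD lB hA hB (inr φA φB x) = inr φA' φB' (lB x) :=
    DFunLike.congr_fun (lift_comp_inr φA φB _ _ _) x
  have hd : inl φA' φB' (φA' d) = inr φA' φB' (φB' d) :=
    DFunLike.congr_fun (inl_comp_eq φA' φB') d
  -- With `d` read in `B'`, both images are `a₁`, `d`, `b`, `a₂` multiplied together, up to the
  -- order of the commuting factors `d` and `b`.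
  simp only [map_mul, hinl, hinr, h₁, h₂, hd]
  simp only [mul_assoc]
  rw [← mul_assoc (inr φA' φB' (φB' d)) (inr φA' φB' (lB b)), ← map_mul, hcomm, map_mul,
    mul_assoc]
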